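/- Let $n,p\ge 1$ be integers, $0\le q\le 1$, and $s_p,M>0$. Let $\mathbf S_p$ be a symmetric positive definite real $p\times p$ matrix with $\operatorname{tr}(\mathbf S_p)=p$ and spectral norm $\|\mathbf S_p\|\le s_{\max}$, belonging to the class $$\mathcal U(q,s_p,M)=\Big\{\mathbf A=(a_{ij})\ \text{symmetric positive definite}:\ a_{ii}\le M,\ \sum_{j=1}^p|a_{ij}|^q\le s_p,\ 1\le i\le p\Big\}$$ (with $0^0=0$ when $q=0$). Let $\mathbf y,\boldsymbol\xi_1,\dots,\boldsymbol\xi_{n-1}$ be i.i.d. $N(\mathbf 0,\mathbf I)$ random vectors in $\mathbb R^p$, and for $r>0$ denote $$Q(r)=\frac1p\,\mathbf y^T\Big(\frac1n\sum_{j=1}^{n-1}\boldsymbol\xi_j\boldsymbol\xi_j^T+\alpha\,\frac np\,\frac1r\,\mathbf S_p^{-1}\Big)^{-1}\mathbf y .$$ Assume that $\alpha>\max\big(0,\;p/n-1+s_{\max}(1+\sqrt{p/n})^2\big)$, and define $$r_{\min}=\frac np\,\frac{\alpha}{1+\alpha-p/n},\qquad r_{\max}=\frac np\,\frac{\alpha}{1+\alpha-p/n-s_{\max}(1+\sqrt{p/n})^2}.$$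 Then $Q(r)$ is integrable for every $r>0$, and there exists a unique $r=r(p,n,\alpha,\mathbf S_p)\in[r_{\min},r_{\max}]$ such that $$\mathbb E[Q(r)]=\frac1{1+\alpha-p/n},$$ where the expectation is over $\mathbf y$ and $\boldsymbol\xi_1,\dots,\boldsymbol\xi_{n-1}$. -/

import Mathlib

open MeasureTheory ProbabilityTheory

noncomputable section

/-- The spectral norm of a real square matrix. -/
def matSpectralNorm {p : ℕ} (A : Matrix (Fin p) (Fin p) ℝ) : ℝ :=
  ‖Matrix.toEuclideanCLM (n := Fin p) (𝕜 := ℝ) A‖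

/-- The class `𝒰(q, s, M)` of approximately sparse positive definite matrices: the diagonal
entries are at most `M` and every row satisfies `∑ j, |a i j| ^ q ≤ s`. The sum runs over the
nonzero entries of the row, so that for `q = 0` it counts them (the convention `0 ^ 0 = 0`). -/
def sparseClass (p : ℕ) (q s M : ℝ) : Set (Matrix (Fin p) (Fin p) ℝ) :=
  {A | A.PosDef ∧ ∀ i, A i i ≤ M ∧ ∑ j with A i j ≠ 0, |A i j| ^ q ≤ s}

/-- The matrix `(1/n) ∑_{j=1}^{n-1} ξ_j ξ_jᵀ + α (n/p) (1/r) S⁻¹`. -/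
def regGram (n p : ℕ) (α : ℝ) (S : Matrix (Fin p) (Fin p) ℝ)
    (ξ : Fin (n - 1) → EuclideanSpace ℝ (Fin p)) (r : ℝ) : Matrix (Fin p) (Fin p) ℝ :=
  (1 / (n : ℝ)) • ∑ j, Matrix.vecMulVec (ξ j).ofLp (ξ j).ofLp
    + (α * ((n : ℝ) / p) * (1 / r)) • S⁻¹

/-- The quadratic form
`Q(r) = (1/p) yᵀ ((1/n) ∑_{j=1}^{n-1} ξ_j ξ_jᵀ + α (n/p) (1/r) S⁻¹)⁻¹ y`. -/
def quadQ (n p : ℕ) (α : ℝ) (S : Matrix (Fin p) (Fin p) ℝ)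
    (y : EuclideanSpace ℝ (Fin p)) (ξ : Fin (n - 1) → EuclideanSpace ℝ (Fin p)) (r : ℝ) : ℝ :=
  (1 / (p : ℝ)) * (y.ofLp ⬝ᵥ ((regGram n p α S ξ r)⁻¹.mulVec y.ofLp))

/-- The random vectors `y, ξ_1, …, ξ_m` in `ℝᵖ` are independent and identically distributed
with the standard Gaussian law `N(0, I)`. -/
structure IsIIDStdGaussian {Ω : Type*} [MeasurableSpace Ω] (P : Measure Ω) {p m : ℕ}
    (y : Ω → EuclideanSpace ℝ (Fin p)) (ξ : Fin m → Ω → EuclideanSpace ℝ (Fin p)) : Prop where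
  law_y : HasLaw y (stdGaussian (EuclideanSpace ℝ (Fin p))) P
  law_ξ : ∀ j, HasLaw (ξ j) (stdGaussian (EuclideanSpace ℝ (Fin p))) P
  indep : iIndepFun (fun i : Option (Fin m) => i.elim y ξ) P

/-- The lower end point `r_min = (n/p) α / (1 + α - p/n)`. -/
def rMin (n p : ℕ) (α : ℝ) : ℝ :=
  (n : ℝ) / p * (α / (1 + α - (p : ℝ) / n))

/-- The upper end point `r_max = (n/p) α / (1 + α - p/n - s_max (1 + √(p/n))²)`. -/
def rMax (n p : ℕ) (α smax : ℝ) : ℝ :=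
  (n : ℝ) / p * (α / (1 + α - (p : ℝ) / n - smax * (1 + √((p : ℝ) / n)) ^ 2))

end

/-! The map `r ↦ E[Q(r)]` is continuous and strictly increasing on `(0, ∞)`, so it suffices to show
that it is at most `1/T` at `r_min` and at least `1/T` at `r_max`, where `T = 1 + α - p/n`; the
intermediate value theorem then gives `r`, and injectivity its uniqueness. Every estimate on `Q`
rests on the variational formula: for positive definite `A`, `yᵀA⁻¹y` is the maximum over `z` of `2
yᵀz - zᵀAz`. Testing `A` at another parameter's maximiser gives monotonicity (`quadQ_add_le`).
Applying it to `S⁻¹` bounds `Q(r)` above by a multiple of `yᵀSy` (`quadQ_le`), whose mean is a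
multiple of `tr S`. Testing with `z = u S y` bounds `Q(r)` below (`le_quadQ`) by quantities with
means `tr S` and `tr S²`, and `tr S² ≤ s_max tr S`. No random matrix theory is needed: only second
moments and independence enter. -/

/-! ### Deterministic matrix inequalities. -/

-- Expand `(z - A⁻¹y)ᵀ A (z - A⁻¹y) ≥ 0`.
open Matrix in
theorem Matrix.PosDef.two_mul_dotProduct_sub_le {n : Type*} [Fintype n] [DecidableEq n]
    {A : Matrix n n ℝ} (hA : A.PosDef) (y z : n → ℝ) :
    2 * (y ⬝ᵥ z) - z ⬝ᵥ A *ᵥ z ≤ y ⬝ᵥ A⁻¹ *ᵥ y := by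
  have hu : IsUnit A.det := (Matrix.isUnit_iff_isUnit_det A).1 hA.isUnit
  have h := hA.posSemidef.dotProduct_mulVec_nonneg (z - A⁻¹ *ᵥ y)
  have h1 : A *ᵥ (A⁻¹ *ᵥ y) = y := by
    rw [mulVec_mulVec, mul_nonsing_inv A hu, one_mulVec]
  have hT : Aᵀ = A := by simpa using hA.isHermitian.eq
  have h2 : (A⁻¹ *ᵥ y) ⬝ᵥ A *ᵥ z = y ⬝ᵥ z := by
    rw [dotProduct_mulVec, ← mulVec_transpose, hT, h1]
  simp only [star_trivial, mulVec_sub, sub_dotProduct, dotProduct_sub, h1, h2] at h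
  rw [dotProduct_comm z y, dotProduct_comm (A⁻¹ *ᵥ y) y] at h
  linarith

-- Write `S = BᵀB` with rows `b_i` of `B`. Then `tr S² = ∑ b_iᵀ S b_i` and `tr S = ∑ |b_i|²`, so the
-- Rayleigh quotient bound applies row by row.
open Matrix in
theorem Matrix.PosSemidef.trace_mul_self_le {n : Type*} [Fintype n] [DecidableEq n]
    {S : Matrix n n ℝ} (hS : S.PosSemidef) {c : ℝ}
    (hc : ‖Matrix.toEuclideanCLM (n := n) (𝕜 := ℝ) S‖ ≤ c) :
    (S * S).trace ≤ c * S.trace := by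
  obtain ⟨B, hB⟩ : ∃ B : Matrix n n ℝ, S = star B * B := by
    open scoped MatrixOrder in
    exact CStarAlgebra.nonneg_iff_eq_star_mul_self.1 hS.nonneg
  have hB' : S = Bᵀ * B := by rw [hB, star_eq_conjTranspose, conjTranspose_eq_transpose_of_trivial]
  have key (x : n → ℝ) : x ⬝ᵥ S *ᵥ x ≤ c * (x ⬝ᵥ x) := by
    have h1 := real_inner_le_norm (WithLp.toLp 2 x)
      (Matrix.toEuclideanCLM (n := n) (𝕜 := ℝ) S (WithLp.toLp 2 x))
    rw [inner_toEuclideanCLM] at h1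
    have h2 := (Matrix.toEuclideanCLM (n := n) (𝕜 := ℝ) S).le_opNorm (WithLp.toLp 2 x)
    have h3 : ‖(WithLp.toLp 2 x : EuclideanSpace ℝ n)‖ ^ 2 = x ⬝ᵥ x := by
      rw [EuclideanSpace.real_norm_sq_eq]; simp [dotProduct, sq]
    rw [← h3]
    nlinarith [norm_nonneg (WithLp.toLp 2 x : EuclideanSpace ℝ n),
      mul_le_mul_of_nonneg_left h2 (norm_nonneg (WithLp.toLp 2 x : EuclideanSpace ℝ n)),
      mul_le_mul_of_nonneg_right hc (sq_nonneg ‖(WithLp.toLp 2 x : EuclideanSpace ℝ n)‖)]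
  have h1 : (S * S).trace = ∑ i, B i ⬝ᵥ S *ᵥ B i := by
    conv_lhs => rw [hB']
    rw [Matrix.mul_assoc, trace_mul_comm, ← hB', Matrix.mul_assoc, trace]
    refine Finset.sum_congr rfl fun i _ => ?_
    rfl
  have h2 : S.trace = ∑ i, B i ⬝ᵥ B i := by
    rw [hB', trace_mul_comm]; rfl
  rw [h1, h2, Finset.mul_sum]
  exact Finset.sum_le_sum fun i _ => key _

/-! ### Second moments of Gaussian quadratic and bilinear forms. -/

section Moments

variable {p m : ℕ}

/-- The joint law of `m + 1` independent standard Gaussian vectors in `ℝᵖ`. -/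
noncomputable abbrev stdGaussianFamily (p m : ℕ) :
    Measure (Option (Fin m) → EuclideanSpace ℝ (Fin p)) :=
  Measure.pi fun _ => stdGaussian (EuclideanSpace ℝ (Fin p))

theorem memLp_two_coord_stdGaussian (a : Fin p) :
    MemLp (fun x : EuclideanSpace ℝ (Fin p) => x a) 2 (stdGaussian _) :=
  IsGaussian.memLp_dual (stdGaussian (EuclideanSpace ℝ (Fin p)))
    (EuclideanSpace.proj a) 2 (by simp)

theorem integrable_coord_mul_coord_stdGaussian (a b : Fin p) :
    Integrable (fun x : EuclideanSpace ℝ (Fin p) => x a * x b) (stdGaussian _) :=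
  (memLp_two_coord_stdGaussian a).integrable_mul (memLp_two_coord_stdGaussian b)

theorem integral_coord_mul_coord_stdGaussian (a b : Fin p) :
    ∫ x : EuclideanSpace ℝ (Fin p), x a * x b ∂(stdGaussian _) = if a = b then 1 else 0 := by
  have h := covarianceBilin_apply (μ := stdGaussian (EuclideanSpace ℝ (Fin p)))
    IsGaussian.memLp_two_id (EuclideanSpace.single a 1) (EuclideanSpace.single b 1)
  rw [covarianceBilin_stdGaussian] at h
  simp only [id, integral_id_stdGaussian, sub_zero,
    EuclideanSpace.inner_single_left] at h
  simp at h
  rw [← h]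
  have h1 : inner ℝ (EuclideanSpace.single a (1 : ℝ)) (EuclideanSpace.single b (1 : ℝ)) =
      if a = b then (1 : ℝ) else 0 := by
    simp [EuclideanSpace.inner_single_left]
  exact h1

theorem integrable_coord_mul_coord_family (i : Option (Fin m)) (a b : Fin p) :
    Integrable (fun z => z i a * z i b) (stdGaussianFamily p m) :=
  (measurePreserving_eval
    (fun _ : Option (Fin m) => stdGaussian (EuclideanSpace ℝ (Fin p)))
    i).integrable_comp_of_integrable (integrable_coord_mul_coord_stdGaussian a b)

theorem integral_coord_mul_coord_family (i : Option (Fin m)) (a b : Fin p) :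
    ∫ z, z i a * z i b ∂(stdGaussianFamily p m) = if a = b then 1 else 0 := by
  rw [← integral_coord_mul_coord_stdGaussian a b]
  exact (measurePreserving_eval
    (fun _ : Option (Fin m) => stdGaussian (EuclideanSpace ℝ (Fin p))) i).hasLaw.integral_comp
    (f := fun x : EuclideanSpace ℝ (Fin p) => x a * x b)
    (integrable_coord_mul_coord_stdGaussian a b).aestronglyMeasurable

theorem indepFun_coord_mul_coord_family {i j : Option (Fin m)} (hij : i ≠ j)
    (a b c d : Fin p) :
    IndepFun (fun z => z i a * z i b) (fun z => z j c * z j d) (stdGaussianFamily p m) := by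
  have h := (iIndepFun_pi (ι := Option (Fin m)) (X := fun _ x => x)
    (μ := fun _ => stdGaussian (EuclideanSpace ℝ (Fin p)))
    (fun _ => aemeasurable_id)).indepFun hij
  exact h.comp (φ := fun x : EuclideanSpace ℝ (Fin p) => x a * x b)
    (ψ := fun x : EuclideanSpace ℝ (Fin p) => x c * x d) (by fun_prop) (by fun_prop)

open Matrix

theorem dotProduct_mulVec_eq_sum (S : Matrix (Fin p) (Fin p) ℝ) (x y : Fin p → ℝ) :
    x ⬝ᵥ S *ᵥ y = ∑ a, ∑ b, S a b * (x a * y b) := by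
  simp only [dotProduct, mulVec, Finset.mul_sum]
  exact Finset.sum_congr rfl fun a _ => Finset.sum_congr rfl fun b _ => by ring

theorem integrable_quadForm (S : Matrix (Fin p) (Fin p) ℝ) (i : Option (Fin m)) :
    Integrable (fun z => (z i).ofLp ⬝ᵥ S *ᵥ (z i).ofLp) (stdGaussianFamily p m) := by
  simp only [dotProduct_mulVec_eq_sum]
  exact integrable_finsetSum _ fun a _ => integrable_finsetSum _ fun b _ =>
    (integrable_coord_mul_coord_family i a b).const_mul _

theorem integral_quadForm (S : Matrix (Fin p) (Fin p) ℝ) (i : Option (Fin m)) :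
    ∫ z, (z i).ofLp ⬝ᵥ S *ᵥ (z i).ofLp ∂(stdGaussianFamily p m) = S.trace := by
  simp only [dotProduct_mulVec_eq_sum]
  have h (a b : Fin p) : Integrable (fun z : Option (Fin m) → EuclideanSpace ℝ (Fin p) =>
      S a b * (z i a * z i b)) (stdGaussianFamily p m) :=
    (integrable_coord_mul_coord_family i a b).const_mul _
  rw [integral_finsetSum _ fun a _ => integrable_finsetSum _ fun b _ => h a b]
  refine Finset.sum_congr rfl fun a _ => ?_
  rw [integral_finsetSum _ fun b _ => h a b]
  simp [integral_const_mul, integral_coord_mul_coord_family]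

theorem sq_dotProduct_mulVec_eq_sum (S : Matrix (Fin p) (Fin p) ℝ) (x y : Fin p → ℝ) :
    (x ⬝ᵥ S *ᵥ y) ^ 2 =
      ∑ a, ∑ b, ∑ c, ∑ d, S a b * S c d * ((x a * x c) * (y b * y d)) := by
  rw [sq, dotProduct_mulVec_eq_sum]
  simp only [Finset.sum_mul, Finset.mul_sum]
  refine Finset.sum_congr rfl fun a _ => Finset.sum_congr rfl fun b _ =>
    Finset.sum_congr rfl fun c _ => Finset.sum_congr rfl fun d _ => by ring

theorem integrable_coord_four {i j : Option (Fin m)} (hij : i ≠ j) (a b c d : Fin p) :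
    Integrable (fun z => (z i a * z i b) * (z j c * z j d)) (stdGaussianFamily p m) :=
  (indepFun_coord_mul_coord_family hij a b c d).integrable_mul
    (integrable_coord_mul_coord_family i a b) (integrable_coord_mul_coord_family j c d)

theorem integral_coord_four {i j : Option (Fin m)} (hij : i ≠ j) (a b c d : Fin p) :
    ∫ z, (z i a * z i b) * (z j c * z j d) ∂(stdGaussianFamily p m) =
      (if a = b then 1 else 0) * (if c = d then 1 else 0) := by
  rw [(indepFun_coord_mul_coord_family hij a b c d).integral_fun_mul_eq_mul_integral
    (integrable_coord_mul_coord_family i a b).aestronglyMeasurable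
    (integrable_coord_mul_coord_family j c d).aestronglyMeasurable,
    integral_coord_mul_coord_family, integral_coord_mul_coord_family]

theorem integrable_sq_bilin (S : Matrix (Fin p) (Fin p) ℝ) {i j : Option (Fin m)}
    (hij : i ≠ j) :
    Integrable (fun z => ((z i).ofLp ⬝ᵥ S *ᵥ (z j).ofLp) ^ 2) (stdGaussianFamily p m) := by
  simp only [sq_dotProduct_mulVec_eq_sum]
  exact integrable_finsetSum _ fun a _ => integrable_finsetSum _ fun b _ =>
    integrable_finsetSum _ fun c _ => integrable_finsetSum _ fun d _ =>
      (integrable_coord_four hij a c b d).const_mul _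

/-- Independence factors the mean of each term of the fourfold sum into two Kronecker deltas, which
leaves the sum of the squared entries of `S`. -/
theorem integral_sq_bilin (S : Matrix (Fin p) (Fin p) ℝ) {i j : Option (Fin m)}
    (hij : i ≠ j) :
    ∫ z, ((z i).ofLp ⬝ᵥ S *ᵥ (z j).ofLp) ^ 2 ∂(stdGaussianFamily p m) = (S * Sᵀ).trace := by
  simp only [sq_dotProduct_mulVec_eq_sum]
  have h (a b c d : Fin p) : Integrable (fun z : Option (Fin m) → EuclideanSpace ℝ (Fin p) =>
      S a b * S c d * ((z i a * z i c) * (z j b * z j d))) (stdGaussianFamily p m) :=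
    (integrable_coord_four hij a c b d).const_mul _
  rw [integral_finsetSum _ fun a _ => integrable_finsetSum _ fun b _ =>
    integrable_finsetSum _ fun c _ => integrable_finsetSum _ fun d _ => h a b c d]
  simp only [trace, diag_apply, mul_apply, transpose_apply]
  refine Finset.sum_congr rfl fun a _ => ?_
  rw [integral_finsetSum _ fun b _ =>
    integrable_finsetSum _ fun c _ => integrable_finsetSum _ fun d _ => h a b c d]
  refine Finset.sum_congr rfl fun b _ => ?_
  rw [integral_finsetSum _ fun c _ => integrable_finsetSum _ fun d _ => h a b c d]
  simp_rw [fun c => integral_finsetSum Finset.univ fun d _ => h a b c d, integral_const_mul,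
    integral_coord_four hij]
  simp

end Moments

/-! ### Pointwise monotonicity, bounds and continuity of `Q`. -/

section QuadQ

open Matrix

variable {n p : ℕ} {α : ℝ} {S : Matrix (Fin p) (Fin p) ℝ}

theorem dotProduct_vecMulVec_mulVec (x v : Fin p → ℝ) :
    x ⬝ᵥ vecMulVec v v *ᵥ x = (v ⬝ᵥ x) ^ 2 := by
  rw [vecMulVec_mulVec, dotProduct_smul, dotProduct_comm x v, op_smul_eq_smul, smul_eq_mul, sq]

theorem dotProduct_regGram_mulVec (ξ : Fin (n - 1) → EuclideanSpace ℝ (Fin p)) (r : ℝ)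
    (x : Fin p → ℝ) :
    x ⬝ᵥ regGram n p α S ξ r *ᵥ x =
      1 / (n : ℝ) * ∑ j, ((ξ j).ofLp ⬝ᵥ x) ^ 2 +
        (α * ((n : ℝ) / p) * (1 / r)) * (x ⬝ᵥ S⁻¹ *ᵥ x) := by
  simp only [regGram, add_mulVec, smul_mulVec, dotProduct_add, dotProduct_smul, smul_eq_mul,
    sum_mulVec, dotProduct_sum, dotProduct_vecMulVec_mulVec]

theorem isHermitian_regGram (hS : S.PosDef) (ξ : Fin (n - 1) → EuclideanSpace ℝ (Fin p)) (r : ℝ) :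
    (regGram n p α S ξ r).IsHermitian := by
  have h := hS.inv.isHermitian.eq
  simp only [conjTranspose_eq_transpose_of_trivial] at h
  simp only [IsHermitian, conjTranspose_eq_transpose_of_trivial, regGram, transpose_add,
    transpose_smul, transpose_sum, transpose_vecMulVec, h]

theorem posDef_regGram (hn : 1 ≤ n) (hp : 1 ≤ p) (hα : 0 < α) (hS : S.PosDef)
    (ξ : Fin (n - 1) → EuclideanSpace ℝ (Fin p)) {r : ℝ} (hr : 0 < r) :
    (regGram n p α S ξ r).PosDef := by
  refine .of_dotProduct_mulVec_pos (isHermitian_regGram hS ξ r) fun x hx => ?_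
  have h := hS.inv.dotProduct_mulVec_pos hx
  have hn' : (0 : ℝ) < n := by exact_mod_cast hn
  have hp' : (0 : ℝ) < p := by exact_mod_cast hp
  rw [star_trivial] at h ⊢
  rw [dotProduct_regGram_mulVec]
  positivity

theorem quadQ_nonneg (hn : 1 ≤ n) (hp : 1 ≤ p) (hα : 0 < α) (hS : S.PosDef)
    (y : EuclideanSpace ℝ (Fin p)) (ξ : Fin (n - 1) → EuclideanSpace ℝ (Fin p))
    {r : ℝ} (hr : 0 < r) : 0 ≤ quadQ n p α S y ξ r := by
  have h := (posDef_regGram hn hp hα hS ξ hr).inv.posSemidef.dotProduct_mulVec_nonneg y.ofLp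
  rw [star_trivial] at h
  unfold quadQ
  positivity

/-- Comparison of `Q` at two values of the parameter, with the gap made explicit. -/
theorem quadQ_add_le (hn : 1 ≤ n) (hp : 1 ≤ p) (hα : 0 < α) (hS : S.PosDef)
    (y : EuclideanSpace ℝ (Fin p)) (ξ : Fin (n - 1) → EuclideanSpace ℝ (Fin p))
    {s t : ℝ} (hs : 0 < s) (ht : 0 < t) :
    quadQ n p α S y ξ s + 1 / p * (α * ((n : ℝ) / p) * (1 / s - 1 / t) *
      (((regGram n p α S ξ s)⁻¹ *ᵥ y.ofLp) ⬝ᵥ S⁻¹ *ᵥ ((regGram n p α S ξ s)⁻¹ *ᵥ y.ofLp))) ≤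
      quadQ n p α S y ξ t := by
  have hps := posDef_regGram hn hp hα hS ξ hs
  -- The maximiser for the parameter `s` is tested at `t`; the two matrices differ only in the
  -- multiple of `S⁻¹`, which makes the gap explicit.
  have h := (posDef_regGram hn hp hα hS ξ ht).two_mul_dotProduct_sub_le y.ofLp
    ((regGram n p α S ξ s)⁻¹ *ᵥ y.ofLp)
  have h1 : regGram n p α S ξ s *ᵥ ((regGram n p α S ξ s)⁻¹ *ᵥ y.ofLp) = y.ofLp := by
    rw [mulVec_mulVec, mul_nonsing_inv _ ((isUnit_iff_isUnit_det _).1 hps.isUnit), one_mulVec]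
  have h2 := dotProduct_regGram_mulVec (α := α) (S := S) ξ s
    ((regGram n p α S ξ s)⁻¹ *ᵥ y.ofLp)
  rw [h1, dotProduct_comm] at h2
  rw [dotProduct_regGram_mulVec ξ t] at h
  unfold quadQ
  rw [← mul_add]
  refine mul_le_mul_of_nonneg_left ?_ (by positivity)
  linarith

theorem quadQ_mono (hn : 1 ≤ n) (hp : 1 ≤ p) (hα : 0 < α) (hS : S.PosDef)
    (y : EuclideanSpace ℝ (Fin p)) (ξ : Fin (n - 1) → EuclideanSpace ℝ (Fin p))
    {s t : ℝ} (hs : 0 < s) (hst : s ≤ t) : quadQ n p α S y ξ s ≤ quadQ n p α S y ξ t := by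
  refine le_trans (le_add_of_nonneg_right ?_) (quadQ_add_le hn hp hα hS y ξ hs (hs.trans_le hst))
  have h := hS.inv.posSemidef.dotProduct_mulVec_nonneg ((regGram n p α S ξ s)⁻¹ *ᵥ y.ofLp)
  have h1 : 0 ≤ 1 / s - 1 / t := sub_nonneg.2 (one_div_le_one_div_of_le hs hst)
  rw [star_trivial] at h
  positivity

theorem quadQ_lt (hn : 1 ≤ n) (hp : 1 ≤ p) (hα : 0 < α) (hS : S.PosDef)
    {y : EuclideanSpace ℝ (Fin p)} (hy : y ≠ 0) (ξ : Fin (n - 1) → EuclideanSpace ℝ (Fin p))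
    {s t : ℝ} (hs : 0 < s) (hst : s < t) : quadQ n p α S y ξ s < quadQ n p α S y ξ t := by
  refine lt_of_lt_of_le (lt_add_of_pos_right _ ?_)
    (quadQ_add_le hn hp hα hS y ξ hs (hs.trans hst))
  have hps := posDef_regGram hn hp hα hS ξ hs
  have hne : (regGram n p α S ξ s)⁻¹ *ᵥ y.ofLp ≠ 0 := by
    intro h0
    have h1 : regGram n p α S ξ s *ᵥ ((regGram n p α S ξ s)⁻¹ *ᵥ y.ofLp) = y.ofLp := by
      rw [mulVec_mulVec, mul_nonsing_inv _ ((isUnit_iff_isUnit_det _).1 hps.isUnit), one_mulVec]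
    rw [h0, mulVec_zero] at h1
    exact hy (by ext i; simp [← h1])
  have h := hS.inv.dotProduct_mulVec_pos hne
  have h1 : 0 < 1 / s - 1 / t := sub_pos.2 (one_div_lt_one_div_of_lt hs hst)
  have hn' : (0 : ℝ) < n := by exact_mod_cast hn
  have hp' : (0 : ℝ) < p := by exact_mod_cast hp
  rw [star_trivial] at h
  positivity

/-- Dropping the Gram part of the regularized matrix bounds `Q` from above. -/
theorem quadQ_le (hn : 1 ≤ n) (hp : 1 ≤ p) (hα : 0 < α) (hS : S.PosDef)
    (y : EuclideanSpace ℝ (Fin p)) (ξ : Fin (n - 1) → EuclideanSpace ℝ (Fin p))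
    {r : ℝ} (hr : 0 < r) :
    quadQ n p α S y ξ r ≤ r / (α * n) * (y.ofLp ⬝ᵥ S *ᵥ y.ofLp) := by
  have hn' : (0 : ℝ) < n := by exact_mod_cast hn
  have hp' : (0 : ℝ) < p := by exact_mod_cast hp
  set A := regGram n p α S ξ r with hA
  set c : ℝ := α * ((n : ℝ) / p) * (1 / r) with hc
  have hc0 : 0 < c := by positivity
  set x := A⁻¹ *ᵥ y.ofLp with hx
  have hpd : A.PosDef := posDef_regGram hn hp hα hS ξ hr
  have h1 : A *ᵥ x = y.ofLp := by
    rw [hx, mulVec_mulVec, mul_nonsing_inv _ ((isUnit_iff_isUnit_det _).1 hpd.isUnit), one_mulVec]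
  have h2 : c * (x ⬝ᵥ S⁻¹ *ᵥ x) ≤ y.ofLp ⬝ᵥ x := by
    have h := dotProduct_regGram_mulVec (α := α) (S := S) ξ r x
    rw [← hA, h1, dotProduct_comm] at h
    rw [h]
    exact le_add_of_nonneg_left (by positivity)
  -- The variational inequality for `S⁻¹` at `c x` reads `2c yᵀx - c² xᵀS⁻¹x ≤ yᵀSy`; by `h2` the
  -- subtracted term is at most `c yᵀx`.
  have h3 := hS.inv.two_mul_dotProduct_sub_le y.ofLp (c • x)
  rw [nonsing_inv_nonsing_inv _ ((isUnit_iff_isUnit_det _).1 hS.isUnit)] at h3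
  simp only [dotProduct_smul, smul_dotProduct, mulVec_smul, smul_eq_mul] at h3
  have h4 : c * (y.ofLp ⬝ᵥ x) ≤ y.ofLp ⬝ᵥ S *ᵥ y.ofLp := by nlinarith
  have h5 : r / (α * n) = 1 / p * (1 / c) := by rw [hc]; field_simp
  unfold quadQ
  rw [h5, mul_assoc]
  refine mul_le_mul_of_nonneg_left ?_ (by positivity)
  rw [one_div, ← div_eq_inv_mul, le_div_iff₀ hc0, mul_comm]
  exact h4

/-- Testing the variational formula for `A⁻¹` with the vector `u • S y` bounds `Q` from below. -/
theorem le_quadQ (hn : 1 ≤ n) (hp : 1 ≤ p) (hα : 0 < α) (hS : S.PosDef)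
    (y : EuclideanSpace ℝ (Fin p)) (ξ : Fin (n - 1) → EuclideanSpace ℝ (Fin p))
    {r : ℝ} (hr : 0 < r) (u : ℝ) :
    1 / (p : ℝ) * (2 * u * (y.ofLp ⬝ᵥ S *ᵥ y.ofLp) -
      u ^ 2 * (1 / (n : ℝ) * ∑ j, ((ξ j).ofLp ⬝ᵥ S *ᵥ y.ofLp) ^ 2 +
        (α * ((n : ℝ) / p) * (1 / r)) * (y.ofLp ⬝ᵥ S *ᵥ y.ofLp))) ≤
      quadQ n p α S y ξ r := by
  have h := (posDef_regGram hn hp hα hS ξ hr).two_mul_dotProduct_sub_le y.ofLp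
    (u • S *ᵥ y.ofLp)
  have h1 : S⁻¹ *ᵥ (S *ᵥ y.ofLp) = y.ofLp := by
    rw [mulVec_mulVec, nonsing_inv_mul _ ((isUnit_iff_isUnit_det _).1 hS.isUnit), one_mulVec]
  simp only [dotProduct_smul, smul_dotProduct, mulVec_smul, smul_eq_mul,
    dotProduct_regGram_mulVec, h1] at h
  rw [dotProduct_comm (S *ᵥ y.ofLp) y.ofLp] at h
  unfold quadQ
  refine mul_le_mul_of_nonneg_left (le_trans (le_of_eq ?_) h) (by positivity)
  ring

theorem continuous_quadQ_family (hn : 1 ≤ n) (hp : 1 ≤ p) (hα : 0 < α) (hS : S.PosDef)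
    {r : ℝ} (hr : 0 < r) :
    Continuous fun z : Option (Fin (n - 1)) → EuclideanSpace ℝ (Fin p) =>
      quadQ n p α S (z none) (fun j => z (some j)) r := by
  have h1 : Continuous fun z : Option (Fin (n - 1)) → EuclideanSpace ℝ (Fin p) =>
      regGram n p α S (fun j => z (some j)) r := by
    unfold regGram
    fun_prop
  have h2 : Continuous fun z : Option (Fin (n - 1)) → EuclideanSpace ℝ (Fin p) =>
      (regGram n p α S (fun j => z (some j)) r)⁻¹ := by
    refine continuous_iff_continuousAt.2 fun z => ?_
    refine ContinuousAt.comp (f := fun z : Option (Fin (n - 1)) → EuclideanSpace ℝ (Fin p) =>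
      regGram n p α S (fun j => z (some j)) r) (g := Inv.inv) ?_ h1.continuousAt
    refine continuousAt_matrix_inv _ ?_
    simp only [Ring.inverse_eq_inv']
    exact continuousAt_inv₀ (posDef_regGram hn hp hα hS _ hr).det_pos.ne'
  unfold quadQ
  exact continuous_const.mul (Continuous.dotProduct (by fun_prop)
    (h2.matrix_mulVec (by fun_prop)))

theorem continuousOn_quadQ (hn : 1 ≤ n) (hp : 1 ≤ p) (hα : 0 < α) (hS : S.PosDef)
    (y : EuclideanSpace ℝ (Fin p)) (ξ : Fin (n - 1) → EuclideanSpace ℝ (Fin p)) :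
    ContinuousOn (fun r => quadQ n p α S y ξ r) (Set.Ioi 0) := by
  intro r hr
  refine ContinuousAt.continuousWithinAt ?_
  have h1 : ContinuousAt (fun r => regGram n p α S ξ r) r := by
    unfold regGram
    exact continuousAt_const.add ((continuousAt_const.mul
      (continuousAt_const.div continuousAt_id (ne_of_gt hr))).smul continuousAt_const)
  have h2 : ContinuousAt (fun r => (regGram n p α S ξ r)⁻¹) r := by
    refine ContinuousAt.comp (f := fun r => regGram n p α S ξ r) (g := Inv.inv) ?_ h1
    refine continuousAt_matrix_inv _ ?_
    simp only [Ring.inverse_eq_inv']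
    exact continuousAt_inv₀ (posDef_regGram hn hp hα hS _ hr).det_pos.ne'
  have h3 : Continuous fun A : Matrix (Fin p) (Fin p) ℝ =>
      1 / (p : ℝ) * (y.ofLp ⬝ᵥ A *ᵥ y.ofLp) :=
    continuous_const.mul (Continuous.dotProduct continuous_const
      (continuous_id.matrix_mulVec continuous_const))
  exact h3.continuousAt.comp h2

end QuadQ

/-! ### The expectation of `Q` as a function of `r`. -/

section Expectation

open Matrix

variable {n p : ℕ} {α : ℝ} {S : Matrix (Fin p) (Fin p) ℝ}

/-- The expectation of `Q(r)` when `y, ξ_1, …, ξ_{n-1}` are i.i.d. standard Gaussian. -/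
noncomputable def expectedQ (n p : ℕ) (α : ℝ) (S : Matrix (Fin p) (Fin p) ℝ) (r : ℝ) : ℝ :=
  ∫ z, quadQ n p α S (z none) (fun j => z (some j)) r ∂(stdGaussianFamily p (n - 1))

theorem integrable_quadQ_family (hn : 1 ≤ n) (hp : 1 ≤ p) (hα : 0 < α) (hS : S.PosDef)
    {r : ℝ} (hr : 0 < r) :
    Integrable (fun z : Option (Fin (n - 1)) → EuclideanSpace ℝ (Fin p) =>
      quadQ n p α S (z none) (fun j => z (some j)) r) (stdGaussianFamily p (n - 1)) := by
  refine ((integrable_quadForm S none).const_mul (r / (α * n))).mono'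
    (continuous_quadQ_family hn hp hα hS hr).aestronglyMeasurable (ae_of_all _ fun z => ?_)
  rw [Real.norm_of_nonneg (quadQ_nonneg hn hp hα hS _ _ hr)]
  exact quadQ_le hn hp hα hS _ _ hr

theorem expectedQ_le (hn : 1 ≤ n) (hp : 1 ≤ p) (hα : 0 < α) (hS : S.PosDef)
    {r : ℝ} (hr : 0 < r) : expectedQ n p α S r ≤ r / (α * n) * S.trace := by
  rw [← integral_quadForm (m := n - 1) S none, ← integral_const_mul]
  exact integral_mono (integrable_quadQ_family hn hp hα hS hr)
    ((integrable_quadForm S none).const_mul _) fun z => quadQ_le hn hp hα hS _ _ hr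

theorem le_expectedQ (hn : 1 ≤ n) (hp : 1 ≤ p) (hα : 0 < α) (hS : S.PosDef)
    {r : ℝ} (hr : 0 < r) (u : ℝ) :
    1 / (p : ℝ) * (2 * u * S.trace -
      u ^ 2 * (((n - 1 : ℕ) : ℝ) / n * (S * S).trace +
        (α * ((n : ℝ) / p) * (1 / r)) * S.trace)) ≤ expectedQ n p α S r := by
  have hT : Sᵀ = S := by simpa using hS.isHermitian.eq
  have hI := integrable_quadForm (m := n - 1) S none
  have hB (j : Fin (n - 1)) :=
    integrable_sq_bilin S (i := some j) (j := none) (by simp)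
  have hsum := (integrable_finsetSum Finset.univ fun j _ => hB j).const_mul (1 / (n : ℝ))
  have hsum' := hsum.add (hI.const_mul (α * ((n : ℝ) / p) * (1 / r)))
  simp only [Pi.add_def] at hsum'
  have hall := ((hI.const_mul (2 * u)).sub (hsum'.const_mul (u ^ 2))).const_mul (1 / (p : ℝ))
  refine le_trans (le_of_eq ?_) (integral_mono hall (integrable_quadQ_family hn hp hα hS hr)
    fun z => le_quadQ hn hp hα hS (z none) (fun j => z (some j)) hr u)
  simp only [Pi.sub_apply]
  rw [integral_const_mul]
  rw [integral_sub (hI.const_mul (2 * u)) (hsum'.const_mul (u ^ 2))]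
  rw [integral_const_mul, integral_const_mul]
  rw [integral_add hsum (hI.const_mul (α * ((n : ℝ) / p) * (1 / r)))]
  rw [integral_const_mul, integral_const_mul, integral_finsetSum _ fun j _ => hB j]
  simp_rw [fun j : Fin (n - 1) => integral_sq_bilin S (i := some j) (j := none) (by simp),
    integral_quadForm, hT]
  simp only [Finset.sum_const, Finset.card_univ, Fintype.card_fin, nsmul_eq_mul]
  ring

/-- A coordinate has second moment one. This is what makes the monotonicity of the expectation
strict. -/
theorem not_ae_eq_zero_family (hp : 1 ≤ p) {m : ℕ} (i : Option (Fin m)) :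
    ¬ (∀ᵐ z ∂(stdGaussianFamily p m), z i = 0) := by
  intro h
  have h1 := integral_coord_mul_coord_family (p := p) i ⟨0, hp⟩ ⟨0, hp⟩
  rw [integral_congr_ae (g := fun _ => 0) (h.mono fun z hz => by simp [hz])] at h1
  simp at h1

theorem strictMonoOn_expectedQ (hn : 1 ≤ n) (hp : 1 ≤ p) (hα : 0 < α) (hS : S.PosDef) :
    StrictMonoOn (expectedQ n p α S) (Set.Ioi 0) := by
  intro s hs t ht hst
  have his := integrable_quadQ_family hn hp hα hS hs
  have hit := integrable_quadQ_family hn hp hα hS ht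
  refine lt_of_le_of_ne (integral_mono his hit fun z => quadQ_mono hn hp hα hS _ _ hs hst.le)
    fun heq => not_ae_eq_zero_family hp (m := n - 1) none ?_
  -- Equal integrals of ordered integrands force equality almost everywhere, whereas `Q` increases
  -- strictly wherever `y ≠ 0`.
  have h := (integral_eq_iff_of_ae_le his hit
    (ae_of_all _ fun z => quadQ_mono hn hp hα hS _ _ hs hst.le)).1 heq
  filter_upwards [h] with z hz
  by_contra hne
  exact (quadQ_lt hn hp hα hS hne _ hs hst).ne hz

theorem continuousOn_expectedQ (hn : 1 ≤ n) (hp : 1 ≤ p) (hα : 0 < α) (hS : S.PosDef)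
    {a b : ℝ} (ha : 0 < a) : ContinuousOn (expectedQ n p α S) (Set.Icc a b) := by
  have hpos {r : ℝ} (hr : r ∈ Set.Icc a b) : 0 < r := ha.trans_le hr.1
  rcases lt_or_ge b a with hab | hab
  · simp [Set.Icc_eq_empty hab.not_ge]
  -- By monotonicity, the value of `Q` at the right end point dominates.
  refine continuousOn_of_dominated (bound := fun z =>
      quadQ n p α S (z none) (fun j => z (some j)) b)
    (fun r hr => (continuous_quadQ_family hn hp hα hS (hpos hr)).aestronglyMeasurable)
    (fun r hr => ae_of_all _ fun z => ?_)
    (integrable_quadQ_family hn hp hα hS (ha.trans_le hab))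
    (ae_of_all _ fun z => (continuousOn_quadQ hn hp hα hS _ _).mono fun r hr => hpos hr)
  rw [Real.norm_of_nonneg (quadQ_nonneg hn hp hα hS _ _ (hpos hr))]
  exact quadQ_mono hn hp hα hS _ _ (hpos hr) hr.2

/-- Reduces every probability space to the product space, so that one `r` serves them all. -/
theorem IsIIDStdGaussian.hasLaw {Ω : Type*} [MeasurableSpace Ω] {P : Measure Ω}
    {m : ℕ} {y : Ω → EuclideanSpace ℝ (Fin p)} {ξ : Fin m → Ω → EuclideanSpace ℝ (Fin p)}
    (h : IsIIDStdGaussian P y ξ) :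
    HasLaw (fun ω (i : Option (Fin m)) => i.elim y ξ ω) (stdGaussianFamily p m) P :=
  iIndepFun.hasLaw_pi (X := fun i : Option (Fin m) => i.elim y ξ)
    (fun i => by cases i with
      | none => exact h.law_y
      | some j => exact h.law_ξ j) h.indep

theorem IsIIDStdGaussian.integrable_quadQ {Ω : Type*} [MeasurableSpace Ω] {P : Measure Ω}
    {y : Ω → EuclideanSpace ℝ (Fin p)} {ξ : Fin (n - 1) → Ω → EuclideanSpace ℝ (Fin p)}
    (h : IsIIDStdGaussian P y ξ) (hn : 1 ≤ n) (hp : 1 ≤ p) (hα : 0 < α) (hS : S.PosDef)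
    {r : ℝ} (hr : 0 < r) :
    Integrable (fun ω => quadQ n p α S (y ω) (fun j => ξ j ω) r) P := by
  have hI := integrable_quadQ_family hn hp hα hS hr
  rw [← h.hasLaw.map_eq] at hI
  exact hI.comp_aemeasurable h.hasLaw.aemeasurable

theorem IsIIDStdGaussian.integral_quadQ {Ω : Type*} [MeasurableSpace Ω] {P : Measure Ω}
    {y : Ω → EuclideanSpace ℝ (Fin p)} {ξ : Fin (n - 1) → Ω → EuclideanSpace ℝ (Fin p)}
    (h : IsIIDStdGaussian P y ξ) (hn : 1 ≤ n) (hp : 1 ≤ p) (hα : 0 < α) (hS : S.PosDef)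
    {r : ℝ} (hr : 0 < r) :
    ∫ ω, quadQ n p α S (y ω) (fun j => ξ j ω) r ∂P = expectedQ n p α S r :=
  h.hasLaw.integral_comp (continuous_quadQ_family hn hp hα hS hr).aestronglyMeasurable

end Expectation

/-! ### End point estimates and conclusion. -/

theorem proposition1 (n p : ℕ) (hn : 1 ≤ n) (hp : 1 ≤ p)
    (q s M smax α : ℝ) (hq0 : 0 ≤ q) (hq1 : q ≤ 1) (hs : 0 < s) (hM : 0 < M)
    (S : Matrix (Fin p) (Fin p) ℝ) (hS : S ∈ sparseClass p q s M)
    (htr : S.trace = p) (hnorm : matSpectralNorm S ≤ smax)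
    (hα : max 0 ((p : ℝ) / n - 1 + smax * (1 + √((p : ℝ) / n)) ^ 2) < α) :
    ∃ r ∈ Set.Icc (rMin n p α) (rMax n p α smax),
      ∀ (Ω : Type*) [MeasurableSpace Ω] (P : Measure Ω) [IsProbabilityMeasure P]
        (y : Ω → EuclideanSpace ℝ (Fin p)) (ξ : Fin (n - 1) → Ω → EuclideanSpace ℝ (Fin p)),
        IsIIDStdGaussian P y ξ →
          (∀ t : ℝ, 0 < t → Integrable (fun ω => quadQ n p α S (y ω) (fun j => ξ j ω) t) P) ∧
          ∫ ω, quadQ n p α S (y ω) (fun j => ξ j ω) r ∂P = 1 / (1 + α - (p : ℝ) / n) ∧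
          ∀ t ∈ Set.Icc (rMin n p α) (rMax n p α smax),
            ∫ ω, quadQ n p α S (y ω) (fun j => ξ j ω) t ∂P = 1 / (1 + α - (p : ℝ) / n) →
              t = r := by
  have hn' : (0 : ℝ) < n := by exact_mod_cast hn
  have hp' : (0 : ℝ) < p := by exact_mod_cast hp
  obtain ⟨hα0, hα1⟩ := max_lt_iff.1 hα
  have hSp : S.PosDef := hS.1
  have htr2 : (S * S).trace ≤ smax * p := by
    rw [← htr]; exact hSp.posSemidef.trace_mul_self_le hnorm
  have hsmax : 0 ≤ smax := (norm_nonneg _).trans hnorm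
  have hsq : smax ≤ smax * (1 + √((p : ℝ) / n)) ^ 2 :=
    le_mul_of_one_le_right hsmax (one_le_pow₀ (by linarith [Real.sqrt_nonneg ((p : ℝ) / n)]))
  set k : ℝ := smax * (1 + √((p : ℝ) / n)) ^ 2 with hk
  set T : ℝ := 1 + α - (p : ℝ) / n with hT
  have hD0 : 0 < T - k := by linarith
  have hT0 : 0 < T := by linarith
  have hrmin0 : 0 < rMin n p α := by unfold rMin; rw [← hT]; positivity
  have hle : rMin n p α ≤ rMax n p α smax := by
    unfold rMin rMax
    rw [← hT, ← hk]
    gcongr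
    linarith
  have hrmax0 := hrmin0.trans_le hle
  -- With `tr S = p`, the upper bound `r p / (α n)` equals `1/T` exactly at `r_min`.
  have hlow : expectedQ n p α S (rMin n p α) ≤ 1 / T := by
    refine (expectedQ_le hn hp hα0 hSp hrmin0).trans (le_of_eq ?_)
    rw [htr]
    unfold rMin
    rw [← hT]
    field_simp
  have hupp : 1 / T ≤ expectedQ n p α S (rMax n p α smax) := by
    have hW : 0 < smax + (T - k) := by linarith
    -- At `r_max` the coefficient of `S⁻¹` is `T - k`, so the lower bound is at least `2u - u² (smax
    -- + T - k)`. This `u` maximises it, with value `1 / (smax + T - k)`, which is at least `1/T`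
    -- because `smax ≤ k`.
    refine le_trans ?_ (le_expectedQ hn hp hα0 hSp hrmax0 (1 / (smax + (T - k))))
    have hc : α * ((n : ℝ) / p) * (1 / rMax n p α smax) = T - k := by
      unfold rMax
      rw [← hT, ← hk]
      field_simp
    have hfrac : ((n - 1 : ℕ) : ℝ) / n ≤ 1 :=
      div_le_one_of_le₀ (by exact_mod_cast Nat.sub_le n 1) hn'.le
    have htr3 : ((n - 1 : ℕ) : ℝ) / n * (S * S).trace ≤ smax * p :=
      (mul_le_mul_of_nonneg_left htr2 (by positivity)).trans
        (mul_le_of_le_one_left (by positivity) hfrac)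
    rw [hc, htr]
    calc 1 / T ≤ 1 / (smax + (T - k)) := one_div_le_one_div_of_le hW (by linarith)
      _ = 1 / (p : ℝ) * (2 * (1 / (smax + (T - k))) * p -
          (1 / (smax + (T - k))) ^ 2 * (smax * p + (T - k) * p)) := by
        rw [← add_mul]; field_simp; ring
      _ ≤ _ := by gcongr
  obtain ⟨r, hr, hrT⟩ := intermediate_value_Icc hle
    (continuousOn_expectedQ hn hp hα0 hSp hrmin0) ⟨hlow, hupp⟩
  refine ⟨r, hr, fun Ω _ P _ y ξ h => ⟨fun t ht => h.integrable_quadQ hn hp hα0 hSp ht, ?_, ?_⟩⟩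
  · rw [h.integral_quadQ hn hp hα0 hSp (hrmin0.trans_le hr.1), hrT]
  · intro t ht hQt
    have ht0 := hrmin0.trans_le ht.1
    rw [h.integral_quadQ hn hp hα0 hSp ht0, ← hrT] at hQt
    exact (strictMonoOn_expectedQ hn hp hα0 hSp).injOn ht0 (hrmin0.trans_le hr.1) hQt
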